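/- Let $\mathbb{D}=\{z\in\mathbb{C}:|z|<1\}$. For a complex-valued harmonic function $f$ on $\mathbb{D}$, write $f_z=\frac12(f_x-if_y)$, $f_{\bar z}=\frac12(f_x+if_y)$, $$\Lambda_f(z)=|f_z(z)|+|f_{\bar z}(z)|,\qquad \lambda_f(z)=\big||f_z(z)|-|f_{\bar z}(z)|\big|,$$ and $$M_f=\sup_{z\in\mathbb{D}}\Lambda_f(z)\in[0,\infty],\qquad m_f=\inf_{z\in\mathbb{D}}\lambda_f(z)\in[0,\infty),\qquad \mu_f=\frac{M_f}{m_f}\in[0,\infty],$$ where $\mu_f=\infty$ if $M_f=\infty$ or $m_f=0$. Let $\mathcal{T}$ be the set of all non-constant complex-valued harmonic functions on $\mathbb{D}$ that are not univalent (not injective on $\mathbb{D}$), and define the harmonic John constant by $$\gamma=\inf_{f\in\mathcal{T}}\mu_f .$$ Then $$e^{\pi/2}\le\gamma\le e^{\pi}.$$ -/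

import Mathlib

open scoped ENNReal

noncomputable section

namespace HarmonicJohn

/-- The open unit disk. -/
def disk : Set ℂ := Metric.ball 0 1

/-- The Wirtinger derivative `f_z = (f_x - i f_y) / 2`. -/
def dz (f : ℂ → ℂ) (z : ℂ) : ℂ :=
  (fderiv ℝ f z 1 - Complex.I * fderiv ℝ f z Complex.I) / 2

/-- The Wirtinger derivative `f_{z̄} = (f_x + i f_y) / 2`. -/
def dzbar (f : ℂ → ℂ) (z : ℂ) : ℂ :=
  (fderiv ℝ f z 1 + Complex.I * fderiv ℝ f z Complex.I) / 2

/-- The maximal dilation `Λ_f(z) = |f_z(z)| + |f_{z̄}(z)|`. -/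
def bigLambda (f : ℂ → ℂ) (z : ℂ) : ℝ := ‖dz f z‖ + ‖dzbar f z‖

/-- The minimal dilation `λ_f(z) = ||f_z(z)| - |f_{z̄}(z)||`. -/
def smallLambda (f : ℂ → ℂ) (z : ℂ) : ℝ := |‖dz f z‖ - ‖dzbar f z‖|

/-- `M_f = sup Λ_f` over the disk, possibly `∞`. -/
def bigM (f : ℂ → ℂ) : ℝ≥0∞ := ⨆ z ∈ disk, ENNReal.ofReal (bigLambda f z)

/-- `m_f = inf λ_f` over the disk; it is always finite. -/
def smallM (f : ℂ → ℂ) : ℝ≥0∞ := ⨅ z ∈ disk, ENNReal.ofReal (smallLambda f z)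

/-- `μ_f = M_f / m_f`. For non-constant harmonic `f` one has `0 < M_f` and `m_f < ∞`, so the
quotient is never `0 / 0` or `∞ / ∞`; it is `∞` exactly when `M_f = ∞` or `m_f = 0`. -/
def mu (f : ℂ → ℂ) : ℝ≥0∞ := bigM f / smallM f

/-- The non-constant complex-valued harmonic mappings of the disk. -/
def nonconstHarmonic : Set (ℂ → ℂ) :=
  {f | InnerProductSpace.HarmonicOnNhd f disk ∧ ¬ ∃ c : ℂ, ∀ z ∈ disk, f z = c}

/-- The univalent (injective) harmonic mappings of the disk. -/
def univalentHarmonic : Set (ℂ → ℂ) :=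
  {f | InnerProductSpace.HarmonicOnNhd f disk ∧ Set.InjOn f disk}

/-- The harmonic John constant: the infimum of `μ_f` over the non-constant harmonic mappings
of the disk that are not univalent. -/
def johnConstant : ℝ≥0∞ := ⨅ f ∈ nonconstHarmonic \ univalentHarmonic, mu f

end HarmonicJohn

end

namespace HarmonicJohn

open Complex Metric Set Filter Topology
open scoped ComplexConjugate

/-! Lower bound. Write `f = h + conj g` with `h`, `g` holomorphic. If `f` takes equal values at two
points, then so does `h + u g` for some unimodular constant `u`, and `|h' + u g'|` lies between
`λ_f` and `Λ_f`. It therefore suffices that a holomorphic `F` with `sup |F'| < e^{π/2} inf |F'|` is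
injective (`injOn_of_norm_deriv_bounds`). For such `F`, `log F'` maps into a vertical strip of width
less than `π/2`. Doubling, rotating and exponentiating sends this strip into the right half-plane,
where Schwarz–Pick gives `(1 - |z|²) |F''/F'| ≤ 1`; Becker's criterion `injOn_of_becker` then
applies.

Becker's criterion is proved with the Loewner chain `f(w) + s w f'(w)`, which is the usual one under
`s = e^{2t} - 1`, `w = e^{-t} z`; the disk `|z|² ≤ r` becomes `|w|² (1 + s) ≤ r`. A collision of two
points in this region could be continued to larger `s`, yet none exists for large `s`.

Upper bound. The maps `(1 - z)^{1 - ic}` with `c > 1` are not injective and have `μ ≤ e^{cπ}`; let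
`c` decrease to `1`. -/

/-! ### Becker's univalence criterion via Loewner chains. -/

/-- A curve of solutions of `G (s, ψ s) = G (s₀, w₀)`, with its derivative at `s₀`. -/
theorem exists_implicit_curve {G : ℂ × ℂ → ℂ} {L : ℂ × ℂ →L[ℂ] ℂ} {u : ℂ × ℂ}
    (hG : HasStrictFDerivAt G L u) {α β : ℂ} (hL : ∀ x y, L (x, y) = α * x + β * y)
    (hβ : β ≠ 0) :
    ∃ ψ : ℂ → ℂ, HasDerivAt ψ (-α / β) u.1 ∧ ψ u.1 = u.2 ∧ ∀ᶠ s in 𝓝 u.1, G (s, ψ s) = G u := by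
  have hinr : L ∘L .inr ℂ ℂ ℂ
      = ((ContinuousLinearEquiv.unitsEquivAut ℂ (Units.mk0 β hβ) : ℂ ≃L[ℂ] ℂ) : ℂ →L[ℂ] ℂ) := by
    ext
    simp [hL]
  have hinv : (L ∘L .inr ℂ ℂ ℂ).IsInvertible := ⟨_, hinr.symm⟩
  have hd := hG.hasStrictFDerivAt_implicitFunctionOfProdDomain hinv
  refine ⟨hG.implicitFunctionOfProdDomain hinv, ?_,
    eq_of_tendsto_nhds (hG.tendsto_implicitFunctionOfProdDomain hinv),
    hG.eventually_apply_implicitFunctionOfProdDomain hinv⟩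
  have h := hd.hasFDerivAt.hasDerivAt
  rw [hinr, ContinuousLinearMap.inverse_equiv] at h
  have e : -α / β = (-((ContinuousLinearEquiv.unitsEquivAut ℂ (Units.mk0 β hβ)).symm :
      ℂ →L[ℂ] ℂ) ∘L (L ∘L .inl ℂ ℂ ℂ)) 1 := by
    simp [hL, ContinuousLinearEquiv.unitsEquivAut, div_eq_mul_inv]
  rw [e]
  exact h

/-- A strictly differentiable map that is non-degenerate in the second variable is locally
injective in that variable, uniformly in the first one. -/
theorem eventually_eq_of_apply_eq {G : ℂ × ℂ → ℂ} {L : ℂ × ℂ →L[ℂ] ℂ} {u : ℂ × ℂ}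
    (hG : HasStrictFDerivAt G L u) {α β : ℂ} (hL : ∀ x y, L (x, y) = α * x + β * y)
    (hβ : β ≠ 0) :
    ∀ᶠ q : (ℂ × ℂ) × (ℂ × ℂ) in 𝓝 (u, u), q.1.1 = q.2.1 → G q.1 = G q.2 → q.1.2 = q.2.2 := by
  have hpos : 0 < ‖β‖ / 2 := by positivity
  filter_upwards [hG.isLittleO.def hpos] with q hq h1 h2
  obtain ⟨⟨s, a⟩, ⟨t, b⟩⟩ := q
  simp only at h1 h2 hq ⊢
  subst h1
  rw [h2, sub_self, zero_sub, norm_neg, Prod.mk_sub_mk, sub_self, hL] at hq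
  simp only [mul_zero, zero_add, norm_mul, Prod.norm_mk, norm_zero] at hq
  rw [max_eq_right (norm_nonneg _)] at hq
  by_contra hne
  have : 0 < ‖a - b‖ := norm_pos_iff.2 (sub_ne_zero.2 hne)
  have : 0 < ‖β‖ := norm_pos_iff.2 hβ
  nlinarith

/-- The Loewner chain attached to `f`, in the parameters `(s, w)`. -/
noncomputable def chain (f : ℂ → ℂ) (p : ℂ × ℂ) : ℂ := f p.2 + p.1 * (p.2 * deriv f p.2)

theorem hasStrictFDerivAt_chain {f : ℂ → ℂ} {s w : ℂ} (hf : AnalyticAt ℂ f w) :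
    ∃ L : ℂ × ℂ →L[ℂ] ℂ, HasStrictFDerivAt (chain f) L (s, w) ∧
      ∀ x y, L (x, y) = w * deriv f w * x
        + ((1 + s) * deriv f w + s * (w * deriv (deriv f) w)) * y := by
  have hs : HasStrictFDerivAt (Prod.snd : ℂ × ℂ → ℂ) (.snd ℂ ℂ ℂ) (s, w) := hasStrictFDerivAt_snd
  have h1 : HasStrictFDerivAt (fun p : ℂ × ℂ => f p.2) _ (s, w) :=
    HasStrictDerivAt.comp_hasStrictFDerivAt (s, w) hf.hasStrictDerivAt hs
  have h2 : HasStrictFDerivAt (fun p : ℂ × ℂ => deriv f p.2) _ (s, w) :=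
    HasStrictDerivAt.comp_hasStrictFDerivAt (h₂ := deriv f) (s, w) hf.deriv.hasStrictDerivAt hs
  have h3 := h1.add (hasStrictFDerivAt_fst.mul (hs.mul h2))
  refine ⟨_, h3, fun x y => ?_⟩
  simp
  ring

/-- The domination behind the non-degeneracy of the chain on the region `r (1 + s) < 1`. -/
theorem norm_mul_lt_of_becker {p q : ℂ} {s r : ℝ} (hp : p ≠ 0) (hs : 0 ≤ s)
    (hr : r * (1 + s) < 1) (hb : (1 - r) * ‖q‖ ≤ ‖p‖) :
    ‖(s : ℂ) * q‖ < ‖(1 + s : ℂ) * p‖ := by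
  have h1 : ‖(1 + s : ℂ)‖ = 1 + s := by
    rw [← Complex.ofReal_one, ← Complex.ofReal_add, Complex.norm_real, Real.norm_of_nonneg]
    linarith
  have hp' : 0 < ‖p‖ := norm_pos_iff.2 hp
  rw [norm_mul, norm_mul, h1, Complex.norm_real, Real.norm_of_nonneg hs]
  rcases (norm_nonneg q).eq_or_lt with h | h
  · rw [← h]; nlinarith
  -- Here `(1 + s)(1 - r) - s = 1 - r(1 + s) > 0`.
  · have : s * ‖q‖ < (1 + s) * (1 - r) * ‖q‖ := by
      apply mul_lt_mul_of_pos_right _ h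
      nlinarith
    nlinarith

/-- The map `ζ ↦ 1 / (1 + ζ)` sends the unit disk to the half-plane `Re > 1/2`; take `ζ = q / p`.
This makes the flow of the chain point inwards. -/
theorem half_lt_re_div {p q : ℂ} (h : ‖q‖ < ‖p‖) : 1 < 2 * (p / (p + q)).re := by
  have hne : p + q ≠ 0 := by
    intro h0
    rw [eq_neg_of_add_eq_zero_left h0, norm_neg] at h
    exact lt_irrefl _ h
  have h2 : 0 < normSq (p + q) := normSq_pos.2 hne
  have h3 : normSq q < normSq p := by
    rw [normSq_eq_norm_sq, normSq_eq_norm_sq]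
    gcongr
  have h4 : (p / (p + q)).re = (p.re * (p + q).re + p.im * (p + q).im) / normSq (p + q) := by
    rw [div_re]; ring
  rw [h4, ← mul_div_assoc, lt_div_iff₀ h2]
  simp only [normSq_apply, add_re, add_im] at *
  nlinarith

/-- The solution curve of the Loewner chain stays in the shrinking disks. -/
theorem chain_continuation {f : ℂ → ℂ} {s₀ r : ℝ} {w : ℂ} (hf : AnalyticAt ℂ f w)
    (hp : deriv f w ≠ 0) (hb : (1 - ‖w‖ ^ 2) * ‖w * deriv (deriv f) w‖ ≤ ‖deriv f w‖)
    (hs : 0 ≤ s₀) (hr0 : 0 < r) (hr : r < 1) (hw : ‖w‖ ^ 2 * (1 + s₀) ≤ r) :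
    ∃ ψ : ℝ → ℂ, ContinuousAt ψ s₀ ∧ ψ s₀ = w ∧ 
      (∀ᶠ s : ℝ in 𝓝 s₀, chain f (s, ψ s) = chain f (s₀, w)) ∧
      ∀ᶠ s in 𝓝[>] s₀, ‖ψ s‖ ^ 2 * (1 + s) ≤ r := by
  obtain ⟨L, hG, hL⟩ := hasStrictFDerivAt_chain (s := s₀) hf
  have hlt := norm_mul_lt_of_becker hp hs (hw.trans_lt hr) hb
  have hβ : (1 + s₀ : ℂ) * deriv f w + s₀ * (w * deriv (deriv f) w) ≠ 0 := by
    intro h0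
    rw [eq_neg_of_add_eq_zero_left h0, norm_neg] at hlt
    exact lt_irrefl _ hlt
  obtain ⟨ψ, hψ, hψ0, hψG⟩ := exists_implicit_curve hG hL hβ
  simp only at hψ hψ0 hψG
  have hψr : HasDerivAt (fun s : ℝ => ψ s) _ s₀ := hψ.comp_ofReal
  have hcont : ContinuousAt (fun s : ℝ => ψ s) s₀ := hψr.continuousAt
  refine ⟨fun s => ψ s, hcont, hψ0, ?_, ?_⟩
  · exact Complex.continuous_ofReal.continuousAt.eventually hψG
  · rcases hw.lt_or_eq with hw | hw
    · have hc : ContinuousAt (fun s : ℝ => ‖ψ s‖ ^ 2 * (1 + s)) s₀ :=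
        (hcont.norm.pow 2).mul (by fun_prop)
      have := hc.eventually_lt_const (u := r) (by simpa [hψ0] using hw)
      exact (this.filter_mono nhdsWithin_le_nhds).mono fun s hs => hs.le
    -- On the boundary of the region, `|ψ|² (1 + s)` has derivative `|w|² (1 - 2 Re (P / (P + Q))) <
    -- 0`, so the curve does not leave as `s` grows.
    · have hd := (hψr.norm_sq).mul ((hasDerivAt_id s₀).const_add 1)
      simp only [id] at hd
      have hwpos : 0 < ‖w‖ ^ 2 := by
        rcases (sq_nonneg ‖w‖).eq_or_lt with h | h
        · rw [← h] at hw; linarith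
        · exact h
      have hneg : (2 * inner ℝ (ψ s₀) (-(w * deriv f w)
          / ((1 + s₀ : ℂ) * deriv f w + s₀ * (w * deriv (deriv f) w)))) * (1 + s₀)
          + ‖ψ s₀‖ ^ 2 * 1 < 0 := by
        have h1 := half_lt_re_div hlt
        rw [hψ0]
        set P := (1 + s₀ : ℂ) * deriv f w with hP
        set Q := (s₀ : ℂ) * (w * deriv (deriv f) w)
        have : (1 + s₀) * inner ℝ w (-(w * deriv f w) / (P + Q)) = - ‖w‖ ^ 2 * (P / (P + Q)).re := by
          have e : inner ℝ w (-(w * deriv f w) / (P + Q)) =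
              -(‖w‖ ^ 2 * (deriv f w / (P + Q)).re) := by
            rw [Complex.inner, ← Complex.normSq_eq_norm_sq, ← Complex.re_ofReal_mul,
              ← Complex.neg_re, Complex.normSq_eq_conj_mul_self]
            congr 1
            ring
          rw [e, hP, mul_div_assoc, ← Complex.ofReal_one, ← Complex.ofReal_add,
            Complex.re_ofReal_mul]
          ring
        nlinarith
      have hev := (hd.hasDerivWithinAt (s := Ioi s₀)).limsup_slope_le' (by simp) hneg
      filter_upwards [hev, self_mem_nhdsWithin] with s h1 h2
      rw [slope_def_field, div_lt_iff₀ (sub_pos.2 h2)] at h1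
      simp only [Pi.mul_apply, hψ0] at h1
      linarith

/-- Near the origin, the chain is injective in `w`, uniformly in `s ≥ 0`. -/
theorem exists_ball_injOn_chain {f : ℂ → ℂ} (hf : AnalyticAt ℂ f 0) (h0 : deriv f 0 ≠ 0) :
    ∃ δ > 0, ∀ s : ℝ, 0 ≤ s → InjOn (fun w => chain f (s, w)) (ball 0 δ) := by
  have hpos : 0 < ‖deriv f 0‖ / 3 := by positivity
  have hc : ContinuousAt (deriv f) 0 := hf.deriv.continuousAt
  have hc2 : ContinuousAt (fun w => w * deriv (deriv f) w) 0 :=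
    continuousAt_id.mul hf.deriv.deriv.continuousAt
  obtain ⟨δ, hδ, H⟩ := Metric.eventually_nhds_iff_ball.1
    ((hf.eventually_analyticAt.and (hc.eventually (ball_mem_nhds _ hpos))).and
      (hc2.eventually (ball_mem_nhds _ hpos)))
  refine ⟨δ, hδ, fun s hs a ha b hb hab => ?_⟩
  simp only at hab
  have hn : ‖(1 + s : ℂ)‖ = 1 + s := by
    rw [← Complex.ofReal_one, ← Complex.ofReal_add, Complex.norm_real, Real.norm_of_nonneg]
    linarith
  -- Without its linear part `(1 + s) f'(0) w`, the chain has Lipschitz constant at most `2/3` of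
  -- `(1 + s) |f'(0)|`, so the linear part separates points for every `s` at once.
  have hd : ∀ w ∈ ball (0 : ℂ) δ, HasDerivWithinAt
      (fun w => chain f (s, w) - (1 + s) * deriv f 0 * w)
      ((1 + s) * (deriv f w - deriv f 0) + s * (w * deriv (deriv f) w)) (ball 0 δ) w := by
    intro w hw
    have hfw := (H w hw).1.1
    have h1 := hfw.differentiableAt.hasDerivAt
    have h2 := hfw.deriv.differentiableAt.hasDerivAt
    have := (h1.add (((hasDerivAt_id w).mul h2).const_mul (s : ℂ))).sub
      ((hasDerivAt_id w).const_mul ((1 + s) * deriv f 0))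
    refine (this.congr_deriv ?_).hasDerivWithinAt
    simp only [id]
    ring
  have hbound : ∀ w ∈ ball (0 : ℂ) δ, ‖(1 + s) * (deriv f w - deriv f 0)
      + s * (w * deriv (deriv f) w)‖ ≤ (1 + s) * (2 * (‖deriv f 0‖ / 3)) := by
    intro w hw
    have h1 : ‖deriv f w - deriv f 0‖ < ‖deriv f 0‖ / 3 := mem_ball_iff_norm.1 (H w hw).1.2
    have h2 : ‖w * deriv (deriv f) w‖ < ‖deriv f 0‖ / 3 := by
      simpa using (H w hw).2
    refine (norm_add_le _ _).trans ?_
    rw [norm_mul, norm_mul _ (w * _), hn, Complex.norm_real, Real.norm_of_nonneg hs]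
    nlinarith [norm_nonneg (w * deriv (deriv f) w)]
  have := (convex_ball (0 : ℂ) δ).norm_image_sub_le_of_norm_hasDerivWithin_le hd hbound ha hb
  rw [hab] at this
  have e : chain f (s, b) - (1 + s) * deriv f 0 * b - (chain f (s, b) - (1 + s) * deriv f 0 * a)
      = -((1 + s) * deriv f 0 * (b - a)) := by ring
  rw [e, norm_neg, norm_mul, norm_mul, hn] at this
  by_contra hne
  have h1 : 0 < ‖b - a‖ := norm_pos_iff.2 (sub_ne_zero.2 (Ne.symm hne))
  have h2 : 0 < (1 + s) * (‖deriv f 0‖ / 3) * ‖b - a‖ := by positivity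
  nlinarith

/-- **Becker's univalence criterion.** -/
theorem injOn_of_becker {f : ℂ → ℂ} (hf : AnalyticOnNhd ℂ f (ball 0 1))
    (hp : ∀ w ∈ ball (0 : ℂ) 1, deriv f w ≠ 0)
    (hb : ∀ w ∈ ball (0 : ℂ) 1,
      (1 - ‖w‖ ^ 2) * ‖w * deriv (deriv f) w‖ ≤ ‖deriv f w‖) :
    InjOn f (ball 0 1) := by
  intro z₁ hz₁ z₂ hz₂ hz
  by_contra hne
  obtain ⟨r, hr0, hr1, hzr₁, hzr₂⟩ : ∃ r : ℝ, 0 < r ∧ r < 1 ∧ ‖z₁‖ ^ 2 ≤ r ∧ ‖z₂‖ ^ 2 ≤ r := by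
    rw [mem_ball_zero_iff] at hz₁ hz₂
    refine ⟨max (1 / 2) (max (‖z₁‖ ^ 2) (‖z₂‖ ^ 2)), by positivity, ?_, by simp, by simp⟩
    simp only [max_lt_iff]
    exact ⟨by norm_num, by nlinarith [norm_nonneg z₁], by nlinarith [norm_nonneg z₂]⟩
  obtain ⟨δ, hδ, hinj⟩ := exists_ball_injOn_chain (hf 0 (by simp)) (hp 0 (by simp))
  have hmem : ∀ {s : ℝ} {w : ℂ}, 0 ≤ s → ‖w‖ ^ 2 * (1 + s) ≤ r → w ∈ ball (0 : ℂ) 1 := by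
    intro s w hs hw
    rw [mem_ball_zero_iff]
    nlinarith [norm_nonneg w, sq_nonneg ‖w‖, mul_nonneg (sq_nonneg ‖w‖) hs]
  set R : Set (ℝ × ℂ × ℂ) := {p | 0 ≤ p.1 ∧ ‖p.2.1‖ ^ 2 * (1 + p.1) ≤ r ∧
    ‖p.2.2‖ ^ 2 * (1 + p.1) ≤ r} with hR
  -- `E` is the set of collisions. It is shown to be compact, so if nonempty it has a point of
  -- largest `s`.
  set E : Set (ℝ × ℂ × ℂ) := {p | p ∈ R ∧
    chain f (p.1, p.2.1) = chain f (p.1, p.2.2) ∧ p.2.1 ≠ p.2.2} with hE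
  have hbdd : ∀ p ∈ E, p.1 ≤ 1 / δ ^ 2 := by
    rintro ⟨s, a, b⟩ ⟨⟨hs, ha, hb'⟩, hab, hne'⟩
    simp only at hs ha hb' hab hne' ⊢
    by_contra! hlt
    have hsmall : ∀ {w : ℂ}, ‖w‖ ^ 2 * (1 + s) ≤ r → w ∈ ball (0 : ℂ) δ := by
      intro w hw
      rw [mem_ball_zero_iff]
      rw [div_lt_iff₀ (by positivity)] at hlt
      by_contra! hle
      have : δ ^ 2 ≤ ‖w‖ ^ 2 := by gcongr
      nlinarith
    exact hne' (hinj s hs (hsmall ha) (hsmall hb') hab)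
  have hRclosed : IsClosed R := by
    have h1 : IsClosed {p : ℝ × ℂ × ℂ | 0 ≤ p.1} := isClosed_le (by fun_prop) (by fun_prop)
    have h2 : IsClosed {p : ℝ × ℂ × ℂ | ‖p.2.1‖ ^ 2 * (1 + p.1) ≤ r} :=
      isClosed_le (by fun_prop) (by fun_prop)
    have h3 : IsClosed {p : ℝ × ℂ × ℂ | ‖p.2.2‖ ^ 2 * (1 + p.1) ≤ r} :=
      isClosed_le (by fun_prop) (by fun_prop)
    exact h1.inter (h2.inter h3)
  have hchain : ∀ {s : ℝ} {w : ℂ}, 0 ≤ s → ‖w‖ ^ 2 * (1 + s) ≤ r →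
      ContinuousAt (chain f) (s, w) := by
    intro s w hs hw
    obtain ⟨L, hL, -⟩ := hasStrictFDerivAt_chain (s := s) (hf w (hmem hs hw))
    exact hL.continuousAt
  have hclosed : IsClosed E := by
    refine isClosed_of_closure_subset fun p hpE => ?_
    have hpR : p ∈ R := hRclosed.closure_subset_iff.2 (fun q hq => hq.1) hpE
    obtain ⟨s, a, b⟩ := p
    obtain ⟨hs, ha, hb'⟩ := hpR
    simp only at hs ha hb'
    have hfreq := mem_closure_iff_frequently.1 hpE
    have hca : ContinuousAt (fun p : ℝ × ℂ × ℂ => chain f (p.1, p.2.1)) (s, a, b) :=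
      ContinuousAt.comp (g := chain f) (f := fun p : ℝ × ℂ × ℂ => ((p.1 : ℂ), p.2.1))
        (hchain hs ha) (by fun_prop)
    have hcb : ContinuousAt (fun p : ℝ × ℂ × ℂ => chain f (p.1, p.2.2)) (s, a, b) :=
      ContinuousAt.comp (g := chain f) (f := fun p : ℝ × ℂ × ℂ => ((p.1 : ℂ), p.2.2))
        (hchain hs hb') (by fun_prop)
    have heq : chain f (s, a) = chain f (s, b) := by
      by_contra hcon
      have := (hca.prodMk hcb).eventually
        ((isOpen_ne_fun continuous_fst continuous_snd).mem_nhds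
          (show ((chain f (s, a), chain f (s, b)) : ℂ × ℂ) ∈ {q : ℂ × ℂ | q.1 ≠ q.2} from hcon))
      exact hfreq (this.mono fun q hq hqE => hq hqE.2.1)
    refine ⟨⟨hs, ha, hb'⟩, heq, ?_⟩
    -- The condition `a ≠ b` is not closed by itself; two colliding points cannot merge in the limit
    -- because the chain is locally injective in `w`, uniformly in `s`.
    rintro (rfl : a = b)
    obtain ⟨L, hG, hL⟩ := hasStrictFDerivAt_chain (s := s) (hf a (hmem hs ha))
    have hlt := norm_mul_lt_of_becker (hp a (hmem hs ha)) hs (ha.trans_lt hr1)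
      (hb a (hmem hs ha))
    have hβ : (1 + s : ℂ) * deriv f a + s * (a * deriv (deriv f) a) ≠ 0 := by
      intro h0
      rw [eq_neg_of_add_eq_zero_left h0, norm_neg] at hlt
      exact lt_irrefl _ hlt
    have hloc := eventually_eq_of_apply_eq hG hL hβ
    have hcont : ContinuousAt (fun p : ℝ × ℂ × ℂ => (((p.1 : ℂ), p.2.1), ((p.1 : ℂ), p.2.2)))
      (s, a, a) := by fun_prop
    exact hfreq ((hcont.eventually hloc).mono fun q hq hqE => hqE.2.2 (hq rfl hqE.2.1))
  have hcompact : IsCompact E := by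
    refine IsCompact.of_isClosed_subset
      ((isCompact_Icc (a := (0 : ℝ)) (b := 1 / δ ^ 2)).prod
        ((isCompact_closedBall (0 : ℂ) 1).prod (isCompact_closedBall (0 : ℂ) 1))) hclosed ?_
    intro p hpE
    exact ⟨⟨hpE.1.1, hbdd p hpE⟩, ball_subset_closedBall (hmem hpE.1.1 hpE.1.2.1),
      ball_subset_closedBall (hmem hpE.1.1 hpE.1.2.2)⟩
  have hnonempty : E.Nonempty :=
    ⟨(0, z₁, z₂), ⟨le_rfl, by simpa using hzr₁, by simpa using hzr₂⟩, by simpa [chain] using hz, hne⟩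
  obtain ⟨⟨s, a, b⟩, ⟨⟨hs, ha, hb'⟩, hab, hne'⟩, hmax⟩ :=
    hcompact.exists_isMaxOn hnonempty continuous_fst.continuousOn
  simp only at hs ha hb' hab hne'
  -- Both points of the last collision move on along level curves of their common value, giving a
  -- later collision.
  obtain ⟨φ, hφc, hφ0, hφG, hφr⟩ := chain_continuation (hf a (hmem hs ha)) (hp a (hmem hs ha))
    (hb a (hmem hs ha)) hs hr0 hr1 ha
  obtain ⟨ψ, hψc, hψ0, hψG, hψr⟩ := chain_continuation (hf b (hmem hs hb')) (hp b (hmem hs hb'))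
    (hb b (hmem hs hb')) hs hr0 hr1 hb'
  have hne'' : ∀ᶠ t in 𝓝 s, φ t ≠ ψ t := (hφc.ne_iff_eventually_ne hψc).1 (by rwa [hφ0, hψ0])
  obtain ⟨t, h1, h2, h3, h4, h5, h6⟩ := (hφr.and (hψr.and
    ((hφG.filter_mono nhdsWithin_le_nhds).and ((hψG.filter_mono nhdsWithin_le_nhds).and
      ((hne''.filter_mono nhdsWithin_le_nhds).and self_mem_nhdsWithin))))).exists
  have hst : s < t := h6
  have hmem' : (t, φ t, ψ t) ∈ E := ⟨⟨hs.trans hst.le, h1, h2⟩, by simp only [h3, h4, hab], h5⟩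
  exact absurd (hmax hmem') (not_le.2 hst)

/-! ### Schwarz–Pick and John's criterion for holomorphic functions. -/

/-- **Schwarz–Pick lemma** for maps of the disk into the right half-plane. -/
theorem schwarz_pick_halfPlane {H : ℂ → ℂ} (hH : DifferentiableOn ℂ H (ball 0 1))
    (hre : ∀ z ∈ ball (0 : ℂ) 1, 0 < (H z).re) {z : ℂ} (hz : z ∈ ball (0 : ℂ) 1) :
    (1 - ‖z‖ ^ 2) * ‖deriv H z‖ ≤ 2 * (H z).re := by
  have hz1 : ‖z‖ < 1 := mem_ball_zero_iff.1 hz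
  have hzsq : normSq z < 1 := by
    rw [normSq_eq_norm_sq]; nlinarith [norm_nonneg z]
  have hden : ∀ ζ ∈ ball (0 : ℂ) 1, 1 + conj z * ζ ≠ 0 := by
    intro ζ hζ h0
    have h1 : ‖ζ‖ < 1 := mem_ball_zero_iff.1 hζ
    have h2 : ‖conj z * ζ‖ = 1 := by
      rw [eq_neg_of_add_eq_zero_right h0, norm_neg, norm_one]
    rw [norm_mul, norm_conj] at h2
    nlinarith [norm_nonneg z, norm_nonneg ζ]
  set m : ℂ → ℂ := fun ζ => (ζ + z) / (1 + conj z * ζ) with hm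
  have hm0 : m 0 = z := by simp [hm]
  have hmaps : MapsTo m (ball 0 1) (ball 0 1) := by
    intro ζ hζ
    have h1 : normSq ζ < 1 := by
      have := mem_ball_zero_iff.1 hζ
      rw [normSq_eq_norm_sq]; nlinarith [norm_nonneg ζ]
    rw [mem_ball_zero_iff, hm, norm_div, div_lt_one (norm_pos_iff.2 (hden ζ hζ))]
    refine lt_of_pow_lt_pow_left₀ 2 (norm_nonneg _) ?_
    rw [← normSq_eq_norm_sq, ← normSq_eq_norm_sq]
    have h2 : 0 < (1 - normSq z) * (1 - normSq ζ) := mul_pos (by linarith) (by linarith)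
    simp only [normSq_apply, add_re, add_im, one_re, one_im, mul_re, mul_im, conj_re,
      conj_im] at h2 ⊢
    nlinarith
  have hmd : ∀ ζ ∈ ball (0 : ℂ) 1, HasDerivAt m
      ((1 * (1 + conj z * ζ) - (ζ + z) * (conj z * 1)) / (1 + conj z * ζ) ^ 2) ζ := by
    intro ζ hζ
    exact ((hasDerivAt_id ζ).add_const z).div
      (((hasDerivAt_id ζ).const_mul (conj z)).const_add 1) (hden ζ hζ)
  have hHd : ∀ w ∈ ball (0 : ℂ) 1, HasDerivAt H (deriv H w) w := fun w hw =>
    (hH.differentiableAt (isOpen_ball.mem_nhds hw)).hasDerivAt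
  have hHm : ∀ ζ ∈ ball (0 : ℂ) 1, HasDerivAt (H ∘ m) (deriv H (m ζ) *
      ((1 * (1 + conj z * ζ) - (ζ + z) * (conj z * 1)) / (1 + conj z * ζ) ^ 2)) ζ :=
    fun ζ hζ => (hHd _ (hmaps hζ)).comp ζ (hmd ζ hζ)
  have hden2 : ∀ w ∈ ball (0 : ℂ) 1, H w + conj (H z) ≠ 0 := by
    intro w hw h0
    have := congrArg re h0
    simp only [add_re, conj_re, zero_re] at this
    linarith [hre w hw, hre z hz]
  -- The disk automorphism `m` takes `0` to `z`, and a Cayley map takes `H z` back to `0`; the claim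
  -- is `|K'(0)| ≤ 1`.
  set K : ℂ → ℂ := fun ζ => ((H ∘ m) ζ - H z) / ((H ∘ m) ζ + conj (H z)) with hK
  have hKd : ∀ ζ ∈ ball (0 : ℂ) 1, HasDerivAt K _ ζ := fun ζ hζ =>
    ((hHm ζ hζ).sub_const (H z)).div ((hHm ζ hζ).add_const (conj (H z))) (hden2 _ (hmaps hζ))
  have hK0 : K 0 = 0 := by simp [hK, hm0]
  have hKmaps : MapsTo K (ball 0 1) (closedBall (K 0) 1) := by
    intro ζ hζ
    rw [hK0, mem_closedBall_zero_iff, hK, norm_div]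
    refine (div_le_one (norm_pos_iff.2 (hden2 _ (hmaps hζ)))).2 ?_
    refine le_of_sq_le_sq ?_ (norm_nonneg _)
    rw [← normSq_eq_norm_sq, ← normSq_eq_norm_sq]
    have h2 := mul_pos (hre _ (hmaps hζ)) (hre z hz)
    simp only [Function.comp_apply, normSq_apply, add_re, add_im, sub_re, sub_im, conj_re, conj_im]
    nlinarith
  have hle := Complex.norm_deriv_le_one_of_mapsTo_ball
    (fun ζ hζ => (hKd ζ hζ).differentiableAt.differentiableWithinAt) hKmaps one_pos
  rw [(hKd 0 (by simp)).deriv] at hle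
  have e1 : H z + conj (H z) = ((2 * (H z).re : ℝ) : ℂ) := by
    rw [add_conj]
  have hpos : 0 < 2 * (H z).re := by linarith [hre z hz]
  have e2 : 1 - z * conj z = ((1 - ‖z‖ ^ 2 : ℝ) : ℂ) := by
    rw [mul_conj, normSq_eq_norm_sq]; push_cast; ring
  simp only [Function.comp_apply, hm0, mul_zero, add_zero, mul_one, one_pow, div_one, zero_add,
    sub_self, zero_mul, sub_zero, e1, e2] at hle
  rw [norm_div, norm_mul, norm_mul, norm_pow, norm_real, norm_real, Real.norm_of_nonneg hpos.le,
    Real.norm_of_nonneg (by nlinarith [norm_nonneg z]), div_le_one (by positivity)] at hle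
  nlinarith

/-- A zero-free holomorphic function on the disk has a holomorphic logarithm. -/
theorem exists_log_of_ne_zero {u : ℂ → ℂ} (hu : AnalyticOnNhd ℂ u (ball 0 1))
    (h0 : ∀ z ∈ ball (0 : ℂ) 1, u z ≠ 0) :
    ∃ l : ℂ → ℂ, ∀ z ∈ ball (0 : ℂ) 1, HasDerivAt l (deriv u z / u z) z ∧ exp (l z) = u z := by
  have hd : DifferentiableOn ℂ (fun z => deriv u z / u z) (ball 0 1) := fun z hz =>
    ((hu z hz).deriv.differentiableAt.div (hu z hz).differentiableAt
      (h0 z hz)).differentiableWithinAt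
  obtain ⟨l, hl0, hl⟩ := hd.isExactOn_ball.with_val_at 0 (log (u 0))
  refine ⟨l, fun z hz => ⟨hl z hz, ?_⟩⟩
  have hderiv : ∀ w ∈ ball (0 : ℂ) 1, HasDerivAt (fun w => u w * exp (-l w)) 0 w := by
    intro w hw
    have := (hu w hw).differentiableAt.hasDerivAt.mul (hl w hw).neg.cexp
    refine this.congr_deriv ?_
    have := h0 w hw
    simp only [Pi.neg_apply]
    field_simp
    ring
  have hconst := (convex_ball (0 : ℂ) 1).is_const_of_fderivWithin_eq_zero (𝕜 := ℂ)
    (fun w hw => (hderiv w hw).differentiableAt.differentiableWithinAt)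
    (fun w hw => by
      rw [fderivWithin_of_isOpen isOpen_ball hw, (hderiv w hw).hasFDerivAt.fderiv]
      ext; simp) hz (mem_ball_self one_pos)
  simp only [hl0, exp_neg, exp_log (h0 0 (by simp)), mul_inv_cancel₀ (h0 0 (by simp))] at hconst
  exact ((mul_inv_eq_one₀ (exp_ne_zero _)).1 hconst).symm

/-- John's univalence criterion for holomorphic functions. -/
theorem injOn_of_norm_deriv_bounds {F : ℂ → ℂ} (hF : AnalyticOnNhd ℂ F (ball 0 1)) {m M : ℝ}
    (hm : 0 < m) (hlow : ∀ z ∈ ball (0 : ℂ) 1, m ≤ ‖deriv F z‖)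
    (hup : ∀ z ∈ ball (0 : ℂ) 1, ‖deriv F z‖ ≤ M) (hM : M < m * Real.exp (Real.pi / 2)) :
    InjOn F (ball 0 1) := by
  have hne : ∀ z ∈ ball (0 : ℂ) 1, deriv F z ≠ 0 := fun z hz =>
    norm_pos_iff.1 (hm.trans_le (hlow z hz))
  have hM0 : 0 < M := hm.trans_le ((hlow 0 (by simp)).trans (hup 0 (by simp)))
  refine injOn_of_becker hF hne fun z hz => ?_
  obtain ⟨l, hl⟩ := exists_log_of_ne_zero (fun z hz => (hF z hz).deriv) hne
  set c : ℝ := (Real.log m + Real.log M) / 2 with hc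
  have hW : Real.log M - Real.log m < Real.pi / 2 := by
    have := Real.log_lt_log hM0 hM
    rw [Real.log_mul hm.ne' (Real.exp_ne_zero _), Real.log_exp] at this
    linarith
  -- `c` is the centre of the strip containing `Re l`. The factor `2i` turns it into `|Im| < π/2`,
  -- where `exp` has positive real part.
  set H : ℂ → ℂ := fun w => exp (2 * I * (l w - c)) with hH
  have hHd : ∀ w ∈ ball (0 : ℂ) 1,
      HasDerivAt H (exp (2 * I * (l w - c)) * (2 * I * (deriv (deriv F) w / deriv F w))) w :=
    fun w hw => (((hl w hw).1.sub_const (c : ℂ)).const_mul (2 * I)).cexp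
  have hre : ∀ w ∈ ball (0 : ℂ) 1, 0 < (H w).re := by
    intro w hw
    have hlog : (l w).re = Real.log ‖deriv F w‖ := by
      rw [← (hl w hw).2, norm_exp, Real.log_exp]
    have h1 := Real.log_le_log hm (hlow w hw)
    have h2 := Real.log_le_log (hm.trans_le (hlow w hw)) (hup w hw)
    have him : (2 * I * (l w - c)).im = 2 * ((l w).re - c) := by simp
    rw [hH, exp_re, him]
    refine mul_pos (Real.exp_pos _) (Real.cos_pos_of_mem_Ioo ⟨?_, ?_⟩) <;>
      rw [hlog, hc] <;> linarith
  have hsp := schwarz_pick_halfPlane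
    (fun w hw => (hHd w hw).differentiableAt.differentiableWithinAt) hre hz
  rw [(hHd z hz).deriv] at hsp
  have hle : (H z).re ≤ ‖H z‖ := re_le_norm _
  have hHpos : 0 < ‖H z‖ := norm_pos_iff.2 (exp_ne_zero _)
  have hz1 : ‖z‖ < 1 := mem_ball_zero_iff.1 hz
  have hsq : 0 ≤ 1 - ‖z‖ ^ 2 := by nlinarith [norm_nonneg z]
  have hFpos : 0 < ‖deriv F z‖ := norm_pos_iff.2 (hne z hz)
  rw [norm_mul, norm_mul (2 * I), norm_div] at hsp
  have h2I : ‖(2 * I : ℂ)‖ = 2 := by simp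
  rw [h2I] at hsp
  have h3 : (1 - ‖z‖ ^ 2) * (‖deriv (deriv F) z‖ / ‖deriv F z‖) ≤ 1 := by
    have : ((1 - ‖z‖ ^ 2) * (‖deriv (deriv F) z‖ / ‖deriv F z‖)) * (2 * ‖H z‖)
        ≤ 1 * (2 * ‖H z‖) := by
      simp only [hH] at hle ⊢
      linarith
    exact le_of_mul_le_mul_right this (by positivity)
  rw [← mul_div_assoc, div_le_one hFpos] at h3
  rw [norm_mul]
  have h4 : ‖z‖ * ‖deriv (deriv F) z‖ ≤ ‖deriv (deriv F) z‖ :=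
    mul_le_of_le_one_left (norm_nonneg _) hz1.le
  exact (mul_le_mul_of_nonneg_left h4 hsq).trans h3

/-! ### Reduction of the harmonic case to the holomorphic one, and the lower bound. -/

/-- A harmonic function on the disk is `h + conj g` with `h`, `g` holomorphic. -/
theorem exists_canonical_decomposition {f : ℂ → ℂ}
    (hf : InnerProductSpace.HarmonicOnNhd f disk) :
    ∃ h g : ℂ → ℂ, AnalyticOnNhd ℂ h disk ∧ AnalyticOnNhd ℂ g disk ∧
      ∀ z ∈ disk, f z = h z + conj (g z) := by
  obtain ⟨A, hA, hA'⟩ := (hf.comp_CLM reCLM).exists_analyticOnNhd_ball_re_eq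
  obtain ⟨B, hB, hB'⟩ := (hf.comp_CLM imCLM).exists_analyticOnNhd_ball_re_eq
  refine ⟨fun z => (A z + I * B z) / 2, fun z => (A z - I * B z) / 2, ?_, ?_, fun z hz => ?_⟩
  · exact fun z hz => ((hA z hz).add (analyticAt_const.mul (hB z hz))).div_const
  · exact fun z hz => ((hA z hz).sub (analyticAt_const.mul (hB z hz))).div_const
  · have h1 : (A z).re = (f z).re := hA' hz
    have h2 : (B z).re = (f z).im := hB' hz
    simp only [map_div₀, map_sub, map_mul, conj_I, conj_ofNat]
    apply Complex.ext
    · simp [h1]; ring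
    · simp [h2]; ring

theorem fderiv_add_conj {f h g : ℂ → ℂ} {z : ℂ} (hh : AnalyticAt ℂ h z)
    (hg : AnalyticAt ℂ g z) (hf : f =ᶠ[𝓝 z] fun w => h w + conj (g w)) (v : ℂ) :
    fderiv ℝ f z v = deriv h z * v + conj (deriv g z * v) := by
  have h1 := hh.differentiableAt.hasDerivAt.hasFDerivAt.restrictScalars ℝ
  have h2 := hg.differentiableAt.hasDerivAt.hasFDerivAt.restrictScalars ℝ
  have h3 : HasFDerivAt (fun w => conj (g w)) _ z :=
    (conjCLE : ℂ →L[ℝ] ℂ).hasFDerivAt.comp z h2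
  rw [hf.fderiv_eq, (h1.fun_add h3).fderiv]
  simp [mul_comm]

theorem dz_eq_deriv {f h g : ℂ → ℂ} {z : ℂ} (hh : AnalyticAt ℂ h z)
    (hg : AnalyticAt ℂ g z) (hf : f =ᶠ[𝓝 z] fun w => h w + conj (g w)) :
    dz f z = deriv h z := by
  rw [dz, fderiv_add_conj hh hg hf, fderiv_add_conj hh hg hf]
  simp only [map_mul, conj_I, map_one]
  linear_combination (-deriv h z / 2 + conj (deriv g z) / 2) * I_mul_I

theorem dzbar_eq_conj_deriv {f h g : ℂ → ℂ} {z : ℂ} (hh : AnalyticAt ℂ h z)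
    (hg : AnalyticAt ℂ g z) (hf : f =ᶠ[𝓝 z] fun w => h w + conj (g w)) :
    dzbar f z = conj (deriv g z) := by
  rw [dzbar, fderiv_add_conj hh hg hf, fderiv_add_conj hh hg hf]
  simp only [map_mul, conj_I, map_one]
  linear_combination (deriv h z / 2 - conj (deriv g z) / 2) * I_mul_I

/-- The univalence criterion for `h + conj g`, by reduction to all `h + u g` with `‖u‖ = 1`. -/
theorem injOn_add_conj {h g : ℂ → ℂ} (hh : AnalyticOnNhd ℂ h disk) (hg : AnalyticOnNhd ℂ g disk)
    {m M : ℝ} (hm : 0 < m) (hlow : ∀ z ∈ disk, m ≤ |‖deriv h z‖ - ‖deriv g z‖|)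
    (hup : ∀ z ∈ disk, ‖deriv h z‖ + ‖deriv g z‖ ≤ M) (hM : M < m * Real.exp (Real.pi / 2)) :
    InjOn (fun z => h z + conj (g z)) disk := by
  intro z₁ hz₁ z₂ hz₂ hz
  have hΔ : h z₁ - h z₂ = -conj (g z₁ - g z₂) := by
    simp only [map_sub] at hz ⊢
    linear_combination hz
  obtain ⟨u, hu, hΔu⟩ : ∃ u : ℂ, ‖u‖ = 1 ∧ h z₁ - h z₂ = -(u * (g z₁ - g z₂)) := by
    by_cases h0 : g z₁ - g z₂ = 0
    · exact ⟨1, norm_one, by rw [hΔ, h0]; simp⟩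
    · refine ⟨conj (g z₁ - g z₂) / (g z₁ - g z₂), ?_, by rw [hΔ, div_mul_cancel₀ _ h0]⟩
      rw [norm_div, norm_conj, div_self (norm_ne_zero_iff.2 h0)]
  have hF : AnalyticOnNhd ℂ (fun z => h z + u * g z) (ball 0 1) := fun z hz' =>
    (hh z hz').add (analyticAt_const.mul (hg z hz'))
  have hd : ∀ z ∈ ball (0 : ℂ) 1,
      deriv (fun z => h z + u * g z) z = deriv h z + u * deriv g z := fun z hz' =>
    ((hh z hz').differentiableAt.hasDerivAt.add
      ((hg z hz').differentiableAt.hasDerivAt.const_mul u)).deriv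
  have hn : ∀ z, ‖u * deriv g z‖ = ‖deriv g z‖ := fun z => by rw [norm_mul, hu, one_mul]
  refine injOn_of_norm_deriv_bounds hF hm (fun z hz' => ?_) (fun z hz' => ?_) hM hz₁ hz₂ ?_
  · refine (hlow z hz').trans ?_
    have := abs_norm_sub_norm_le (deriv h z) (-(u * deriv g z))
    rwa [norm_neg, hn, sub_neg_eq_add, ← hd z hz'] at this
  · refine le_trans ?_ (hup z hz')
    rw [hd z hz', ← hn z]
    exact norm_add_le _ _
  · simp only
    linear_combination hΔu

theorem exp_half_pi_le_mu {f : ℂ → ℂ} (hf : f ∈ nonconstHarmonic \ univalentHarmonic) :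
    ENNReal.ofReal (Real.exp (Real.pi / 2)) ≤ mu f := by
  obtain ⟨⟨hharm, hnc⟩, hnu⟩ := hf
  obtain ⟨h, g, hh, hg, hfe⟩ := exists_canonical_decomposition hharm
  have hev : ∀ z ∈ disk, f =ᶠ[𝓝 z] fun w => h w + conj (g w) := fun z hz =>
    Filter.eventually_of_mem (isOpen_ball.mem_nhds hz) hfe
  have hbig : ∀ z ∈ disk, bigLambda f z = ‖deriv h z‖ + ‖deriv g z‖ := fun z hz => by
    rw [bigLambda, dz_eq_deriv (hh z hz) (hg z hz) (hev z hz),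
      dzbar_eq_conj_deriv (hh z hz) (hg z hz) (hev z hz), norm_conj]
  have hsmall : ∀ z ∈ disk, smallLambda f z = |‖deriv h z‖ - ‖deriv g z‖| := fun z hz => by
    rw [smallLambda, dz_eq_deriv (hh z hz) (hg z hz) (hev z hz),
      dzbar_eq_conj_deriv (hh z hz) (hg z hz) (hev z hz), norm_conj]
  have h0 : (0 : ℂ) ∈ disk := mem_ball_self one_pos
  -- Non-constancy enters here: it excludes `0 / 0`, which is `0` in `ℝ≥0∞`, so that `m_f = 0`
  -- forces `mu f = ⊤`.
  have hMne : bigM f ≠ 0 := by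
    intro hM
    apply hnc
    have hzero : ∀ z ∈ disk, deriv h z = 0 ∧ deriv g z = 0 := by
      intro z hz
      have h1 : ENNReal.ofReal (bigLambda f z) ≤ 0 := hM ▸ le_iSup₂ (f := fun z (_ : z ∈ disk) =>
        ENNReal.ofReal (bigLambda f z)) z hz
      rw [nonpos_iff_eq_zero, ENNReal.ofReal_eq_zero, hbig z hz] at h1
      exact ⟨norm_le_zero_iff.1 (by linarith [norm_nonneg (deriv g z)]),
        norm_le_zero_iff.1 (by linarith [norm_nonneg (deriv h z)])⟩
    have hconst : ∀ {k : ℂ → ℂ}, AnalyticOnNhd ℂ k disk → (∀ z ∈ disk, deriv k z = 0) →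
        ∀ z ∈ disk, k z = k 0 := by
      intro k hk hk' z hz
      refine (convex_ball (0 : ℂ) 1).is_const_of_fderivWithin_eq_zero (𝕜 := ℂ)
        hk.differentiableOn (fun w hw => ?_) hz h0
      rw [fderivWithin_of_isOpen isOpen_ball hw]
      ext
      simpa using hk' w hw
    exact ⟨h 0 + conj (g 0), fun z hz => by
      rw [hfe z hz, hconst hh (fun z hz => (hzero z hz).1) z hz,
        hconst hg (fun z hz => (hzero z hz).2) z hz]⟩
  have hmle : ∀ z ∈ disk, smallM f ≤ ENNReal.ofReal (smallLambda f z) := fun z hz =>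
    iInf₂_le z hz
  have hMle : ∀ z ∈ disk, ENNReal.ofReal (bigLambda f z) ≤ bigM f := fun z hz =>
    le_iSup₂ (f := fun z (_ : z ∈ disk) => ENNReal.ofReal (bigLambda f z)) z hz
  have hmtop : smallM f ≠ ⊤ := ne_top_of_le_ne_top ENNReal.ofReal_ne_top (hmle 0 h0)
  by_contra! hlt
  have hm0 : smallM f ≠ 0 := by
    intro hm
    rw [mu, hm, ENNReal.div_zero hMne] at hlt
    exact not_top_lt hlt
  rw [mu, ENNReal.div_lt_iff (Or.inl hm0) (Or.inl hmtop)] at hlt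
  have hMtop : bigM f ≠ ⊤ := hlt.ne_top
  apply hnu
  refine ⟨hharm, ?_⟩
  have hinj : InjOn (fun z => h z + conj (g z)) disk := by
    refine injOn_add_conj hh hg (m := (smallM f).toReal) (M := (bigM f).toReal)
      (ENNReal.toReal_pos hm0 hmtop) (fun z hz => ?_) (fun z hz => ?_) ?_
    · rw [← hsmall z hz]
      exact ENNReal.toReal_le_of_le_ofReal (abs_nonneg _) (hmle z hz)
    · rw [← hbig z hz]
      exact (ENNReal.ofReal_le_iff_le_toReal hMtop).1 (hMle z hz)
    · have := (ENNReal.toReal_lt_toReal hMtop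
        (ENNReal.mul_ne_top ENNReal.ofReal_ne_top hmtop)).2 hlt
      rw [ENNReal.toReal_mul, ENNReal.toReal_ofReal (Real.exp_pos _).le] at this
      linarith
  exact hinj.congr fun z hz => (hfe z hz).symm

/-! ### Spiral maps and the upper bound. -/

/-- The spiral maps `(1 - z) ^ (1 - i c)`. -/
noncomputable def spiral (c : ℝ) (z : ℂ) : ℂ := (1 - z) ^ (1 - c * I)

theorem one_sub_re_pos {z : ℂ} (hz : z ∈ disk) : 0 < (1 - z).re := by
  have h1 : ‖z‖ < 1 := mem_ball_zero_iff.1 hz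
  have h2 := re_le_norm z
  simp only [sub_re, one_re]
  linarith

theorem one_sub_mem_slitPlane {z : ℂ} (hz : z ∈ disk) : 1 - z ∈ slitPlane :=
  Or.inl (one_sub_re_pos hz)

theorem analyticAt_spiral (c : ℝ) {z : ℂ} (hz : z ∈ disk) : AnalyticAt ℂ (spiral c) z :=
  (analyticAt_const.sub analyticAt_id).cpow analyticAt_const (one_sub_mem_slitPlane hz)

theorem norm_deriv_spiral (c : ℝ) {z : ℂ} (hz : z ∈ disk) :
    ‖deriv (spiral c) z‖ = ‖(1 - c * I : ℂ)‖ * Real.exp (c * arg (1 - z)) := by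
  have hs := one_sub_mem_slitPlane hz
  have h1 : HasDerivAt (spiral c) ((1 - c * I) * (1 - z) ^ (1 - c * I - 1) * (-1)) z :=
    ((hasDerivAt_id z).const_sub 1).cpow_const hs
  rw [h1.deriv, norm_mul, norm_mul, norm_neg, norm_one, mul_one,
    cpow_def_of_ne_zero (slitPlane_ne_zero hs), norm_exp]
  congr 2
  simp [log_im, mul_comm]

/-- In the coordinate `w = log (1 - z)` the map is `exp (w (1 - ic))`, and the disk is `Re w < log
(2 cos (Im w))`, `|Im w| < π/2`. Two points whose difference is a period `2πi / (1 - ic)` fit in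
this region once `c > 1`. -/
theorem not_injOn_spiral {c : ℝ} (hc : 1 < c) : ¬ InjOn (spiral c) disk := by
  have hc2 : 0 < 1 + c ^ 2 := by positivity
  set β := Real.pi / (1 + c ^ 2) with hβ
  have hβ0 : 0 < β := by positivity
  have hβ2 : β < Real.pi / 2 := div_lt_div_of_pos_left Real.pi_pos two_pos (by nlinarith)
  have hcos : 0 < Real.cos β := Real.cos_pos_of_mem_Ioo ⟨by linarith, hβ2⟩
  have hexp : ∀ w : ℂ, w.re ≤ Real.log (Real.cos β) → |w.im| = β → 1 - exp w ∈ disk := by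
    intro w hw him
    have hr : Real.exp w.re ≤ Real.cos β := by
      rwa [← Real.le_log_iff_exp_le hcos]
    have hcw : Real.cos w.im = Real.cos β := by rw [← him, Real.cos_abs]
    have hpos := Real.exp_pos w.re
    rw [disk, mem_ball_zero_iff]
    refine lt_of_pow_lt_pow_left₀ 2 zero_le_one ?_
    rw [← normSq_eq_norm_sq, normSq_apply]
    simp only [sub_re, sub_im, one_re, one_im, exp_re, exp_im, hcw]
    have := Real.sin_sq_add_cos_sq w.im
    rw [hcw] at this
    have h2 : Real.exp w.re * Real.exp w.re < 2 * (Real.exp w.re * Real.cos β) := by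
      nlinarith [mul_pos hpos hcos]
    nlinarith
  have hval : ∀ w : ℂ, |w.im| = β → spiral c (1 - exp w) = exp (w * (1 - c * I)) := by
    intro w him
    have := abs_le.1 him.le
    rw [spiral, sub_sub_cancel, cpow_def_of_ne_zero (exp_ne_zero _),
      log_exp (by linarith) (by linarith)]
  -- The difference `w₁ - w₂ = 2β(c - i)` times `1 - ic` is `-2βi(1 + c²) = -2πi`, which fixes `β`;
  -- `c > 1` is what makes `β < π/2`.
  set w₁ : ℂ := ⟨Real.log (Real.cos β), -β⟩ with hw₁
  set w₂ : ℂ := ⟨Real.log (Real.cos β) - 2 * c * β, β⟩ with hw₂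
  have him₁ : |w₁.im| = β := by simp [hw₁, abs_of_pos hβ0]
  have him₂ : |w₂.im| = β := by simp [hw₂, abs_of_pos hβ0]
  have hm₁ := hexp w₁ le_rfl him₁
  have hm₂ := hexp w₂ (by simp only [hw₂]; nlinarith) him₂
  have hβeq : (1 + c ^ 2) * β = Real.pi := mul_div_cancel₀ _ hc2.ne'
  intro hinj
  have heq : spiral c (1 - exp w₁) = spiral c (1 - exp w₂) := by
    rw [hval w₁ him₁, hval w₂ him₂]
    refine exp_eq_exp_iff_exists_int.2 ⟨-1, ?_⟩
    apply Complex.ext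
    · simp [hw₁, hw₂]; ring
    · simp [hw₁, hw₂]
      linear_combination (-2) * hβeq
  have h1 := sub_right_injective (hinj hm₁ hm₂ heq)
  have h2 := congrArg (fun x => (‖x‖ : ℝ)) h1
  simp only [norm_exp, Real.exp_eq_exp, hw₁, hw₂] at h2
  nlinarith

theorem spiral_mem {c : ℝ} (hc : 1 < c) : spiral c ∈ nonconstHarmonic \ univalentHarmonic := by
  refine ⟨⟨fun z hz => (analyticAt_spiral c hz).harmonicAt, ?_⟩,
    fun h => not_injOn_spiral hc h.2⟩
  rintro ⟨k, hk⟩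
  have h0 : (0 : ℂ) ∈ disk := mem_ball_self one_pos
  have hev : spiral c =ᶠ[𝓝 0] fun _ => k :=
    Filter.eventually_of_mem (isOpen_ball.mem_nhds h0) hk
  have h1 := norm_deriv_spiral c h0
  rw [hev.deriv_eq, deriv_const, norm_zero] at h1
  have h2 : (1 - c * I : ℂ) ≠ 0 := fun h => by simpa using congrArg re h
  have : 0 < ‖(1 - c * I : ℂ)‖ * Real.exp (c * arg (1 - 0)) := by positivity
  linarith

theorem mu_spiral_le {c : ℝ} (hc : 1 < c) :
    mu (spiral c) ≤ ENNReal.ofReal (Real.exp (c * Real.pi)) := by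
  have h2 : (1 - c * I : ℂ) ≠ 0 := fun h => by simpa using congrArg re h
  have hN : 0 < ‖(1 - c * I : ℂ)‖ := norm_pos_iff.2 h2
  have hev : ∀ z, spiral c =ᶠ[𝓝 z] fun w => spiral c w + conj ((fun _ => (0 : ℂ)) w) := fun z =>
    .of_forall fun w => by simp
  have hbig : ∀ z ∈ disk, bigLambda (spiral c) z = ‖deriv (spiral c) z‖ := fun z hz => by
    rw [bigLambda, dz_eq_deriv (analyticAt_spiral c hz) analyticAt_const (hev z),
      dzbar_eq_conj_deriv (analyticAt_spiral c hz) analyticAt_const (hev z)]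
    simp
  have hsmall : ∀ z ∈ disk, smallLambda (spiral c) z = ‖deriv (spiral c) z‖ := fun z hz => by
    rw [smallLambda, dz_eq_deriv (analyticAt_spiral c hz) analyticAt_const (hev z),
      dzbar_eq_conj_deriv (analyticAt_spiral c hz) analyticAt_const (hev z)]
    simp
  have harg : ∀ z ∈ disk, |arg (1 - z)| ≤ Real.pi / 2 := fun z hz =>
    abs_arg_le_pi_div_two_iff.2 (one_sub_re_pos hz).le
  have hup : bigM (spiral c)
      ≤ ENNReal.ofReal (‖(1 - c * I : ℂ)‖ * Real.exp (c * (Real.pi / 2))) := by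
    refine iSup₂_le fun z hz => ENNReal.ofReal_le_ofReal ?_
    rw [hbig z hz, norm_deriv_spiral c hz]
    have := (abs_le.1 (harg z hz)).2
    gcongr
  have hlow : ENNReal.ofReal (‖(1 - c * I : ℂ)‖ * Real.exp (c * (-(Real.pi / 2))))
      ≤ smallM (spiral c) := by
    refine le_iInf₂ fun z hz => ENNReal.ofReal_le_ofReal ?_
    rw [hsmall z hz, norm_deriv_spiral c hz]
    have := (abs_le.1 (harg z hz)).1
    gcongr
  refine (ENNReal.div_le_div hup hlow).trans_eq ?_
  rw [← ENNReal.ofReal_div_of_pos (by positivity), mul_div_mul_left _ _ hN.ne', ← Real.exp_sub]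
  congr 2
  ring

theorem johnConstant_le_exp_pi : johnConstant ≤ ENNReal.ofReal (Real.exp Real.pi) := by
  have hlim : Tendsto (fun c : ℝ => ENNReal.ofReal (Real.exp (c * Real.pi))) (𝓝[>] 1)
      (𝓝 (ENNReal.ofReal (Real.exp (1 * Real.pi)))) := by
    refine Tendsto.mono_left (Continuous.tendsto ?_ 1) nhdsWithin_le_nhds
    exact ENNReal.continuous_ofReal.comp (by fun_prop)
  rw [one_mul] at hlim
  refine ge_of_tendsto hlim ?_
  filter_upwards [self_mem_nhdsWithin] with c hc
  exact (iInf₂_le (spiral c) (spiral_mem hc)).trans (mu_spiral_le hc)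

end HarmonicJohn

theorem theorem2 :
    ENNReal.ofReal (Real.exp (Real.pi / 2)) ≤ HarmonicJohn.johnConstant ∧
      HarmonicJohn.johnConstant ≤ ENNReal.ofReal (Real.exp Real.pi) :=
  ⟨le_iInf₂ fun _ hf => HarmonicJohn.exp_half_pi_le_mu hf, HarmonicJohn.johnConstant_le_exp_pi⟩
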